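/- Let $0<b<a$ and let $\gamma$ be the ellipse $\frac{x^2}{a^2}+\frac{y^2}{b^2}=1$ with center $O$ and foci $F_{1,2}=(\mp\sqrt{a^2-b^2},0)$. Let $E$ be an ellipse $\frac{x^2}{A^2}+\frac{y^2}{B^2}=1$ ($A,B>0$) confocal with $\gamma$, that is, $A^2-B^2=a^2-b^2$. Let $M_1,\dots,M_n$ ($M_{i+n}=M_i$) be an $n$-periodic billiard orbit in $E$, $n$ being its least period, which circumscribes $\gamma$: the points $M_i$ lie on $E$, consecutive ones are distinct, at every $M_i$ the direction of motion is reflected in the tangent line of $E$ according to the law of equal angles, and every line $M_iM_{i+1}$ is tangent to $\gamma$. For a point $P$, let $R_i(P)$ be the foot of the perpendicular dropped from $P$ on the line $M_iM_{i+1}$. (1) If $n$ is even, then $$\prod_{i=1}^n |F_1R_i(F_1)| = b^n \qquad\text{and}\qquad \prod_{i=1}^n |F_2R_i(F_2)| = b^n .$$ (2) If $n$ is divisible by $4$, then $$\prod_{i=1}^n |O R_i(O)| = (ab)^{n/2}.$$ In particular, these products do not depend on the orbit $M$ in the one-parameter family of $n$-periodic billiard orbits in $E$ that circumscribe $\gamma$.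 -/

import Mathlib

noncomputable section

/-- The Euclidean plane. -/
abbrev Plane : Type := EuclideanSpace ℝ (Fin 2)

/-- The ellipse with center `0` and semi-axes `p`, `q` along the coordinate axes. -/
def ellipse (p q : ℝ) : Set Plane :=
  {X | X 0 ^ 2 / p ^ 2 + X 1 ^ 2 / q ^ 2 = 1}

/-- An outer normal vector (half the gradient) of the ellipse with semi-axes `p`, `q`
at its point `X`. -/
def ellipseNormal (p q : ℝ) (X : Plane) : Plane :=
  !₂[X 0 / p ^ 2, X 1 / q ^ 2]

/-- The direction of the tangent line of the ellipse at `X`: the vectors orthogonal to the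
normal. -/
def tangentDirection (p q : ℝ) (X : Plane) : Submodule ℝ Plane :=
  (Submodule.span ℝ {ellipseNormal p q X})ᗮ

/-- The tangent line of the ellipse with semi-axes `p`, `q` at its point `X`. -/
def ellipseTangentLine (p q : ℝ) (X : Plane) : AffineSubspace ℝ Plane :=
  AffineSubspace.mk' X (tangentDirection p q X)

/-- The line `l` is tangent to the ellipse with semi-axes `p`, `q`. -/
def IsTangentToEllipse (p q : ℝ) (l : AffineSubspace ℝ Plane) : Prop :=
  ∃ T ∈ ellipse p q, l = ellipseTangentLine p q T

/-- The unit vector pointing from `X` to `Y` (for `X ≠ Y`). -/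
def unitDirection (X Y : Plane) : Plane := ‖Y - X‖⁻¹ • (Y - X)

/-- `M 0, M 1, M 2, …` are the successive impact points of a billiard trajectory in the ellipse
with semi-axes `A`, `B`: at each impact, the direction of motion is reflected in the tangent
line. -/
structure IsBilliardTrajectory (A B : ℝ) (M : ℕ → Plane) : Prop where
  mem_ellipse : ∀ i, M i ∈ ellipse A B
  ne_succ : ∀ i, M i ≠ M (i + 1)
  reflection_law : ∀ i,
    unitDirection (M (i + 1)) (M (i + 2)) =
      (tangentDirection A B (M (i + 1))).reflection (unitDirection (M i) (M (i + 1)))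

/-- A sequence is `n`-periodic, with `n ≥ 1` its least period. -/
def HasLeastPeriod {α : Type*} (M : ℕ → α) (n : ℕ) : Prop :=
  IsLeast {m : ℕ | 0 < m ∧ Function.Periodic M m} n

/-- An `n`-periodic billiard orbit (a billiard `n`-gon) `M 0, …, M (n - 1)`, `M n = M 0`, … in
the ellipse with semi-axes `A`, `B`. -/
structure IsPeriodicBilliardOrbit (A B : ℝ) (n : ℕ) (M : ℕ → Plane) : Prop where
  trajectory : IsBilliardTrajectory A B M
  period : HasLeastPeriod M n

/-- The line containing the side of the polygon that joins `M i` to `M (i + 1)`. -/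
def sideLine (M : ℕ → Plane) (i : ℕ) : AffineSubspace ℝ Plane :=
  line[ℝ, M i, M (i + 1)]

instance (M : ℕ → Plane) (i : ℕ) : Nonempty (sideLine M i) :=
  ⟨⟨M i, left_mem_affineSpan_pair ℝ (M i) (M (i + 1))⟩⟩

/-- The polygon circumscribes the ellipse with semi-axes `a`, `b`: the lines containing its sides
are tangent to that ellipse. -/
def Circumscribes (M : ℕ → Plane) (a b : ℝ) : Prop :=
  ∀ i, IsTangentToEllipse a b (sideLine M i)

/-- The foot of the perpendicular dropped from `P` on the line `M i`, `M (i + 1)`. -/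
def footOnSide (M : ℕ → Plane) (P : Plane) (i : ℕ) : Plane :=
  EuclideanGeometry.orthogonalProjection (sideLine M i) P

/-- The focus `(-c, 0)`, `c = √(a² - b²)`, of the ellipse with semi-axes `b ≤ a`. -/
def focus₁ (a b : ℝ) : Plane := !₂[-√(a ^ 2 - b ^ 2), 0]

/-- The focus `(c, 0)`, `c = √(a² - b²)`, of the ellipse with semi-axes `b ≤ a`. -/
def focus₂ (a b : ℝ) : Plane := !₂[√(a ^ 2 - b ^ 2), 0]

end

/-! Write the points of tangency with γ as (a cos tᵢ, ±b sin tᵢ), the sign being fixed along the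
orbit. Two tangents meet on E exactly when P cos s cos t + Q sin s sin t = R, where α = a²/A², β =
b²/B², P = 1 - α + β, Q = 1 + α - β, R = α + β - 1. Since |R| < P and |R| < Q, this relation defines
an increasing map s ↦ t with s < t < s + π, and the orbit iterates it. After n steps the angle has
grown by 2πk, k being the winding number.

Let an increasing map g respect the relation and satisfy g^q = (+2π). If n = qm, comparison of
orbits forces t_{i+m} = g^k(tᵢ) (`shift_eq_iterate`). The half turn (q = 2) gives t_{i+m} = tᵢ + kπ;
here k is odd, because an even k would make n/2 a period. The `quarterShift` (q = 4) respects the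
relation because E and γ are confocal (`IsNextAngle.map_quarterShift`); its square is the half turn.

With D(t)² = b² cos² t + a² sin² t, the distance from (f, 0) to the tangent at angle t is b(a - f
cos t)/D(t). For a focus, D² = a² - f² cos² t, so the distances at t and t + π multiply to b². For
the center the distance is ab/D, and D(t) D(g(t)) = ab, so the distances at t and at an odd iterate
of g multiply to ab. Pairing i with i + m over a whole period gives the square of each product. -/

/-! ### Consecutive tangency angles -/

/-- For the angles `s`, `t` of two points of tangency on an ellipse: `t` follows `s` in the
counterclockwise direction, and the tangents meet on the conic encoded by `P`, `Q`, `R`. -/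
structure IsNextAngle (P Q R s t : ℝ) : Prop where
  lt : s < t
  lt_add_pi : t < s + Real.pi
  eq : P * (Real.cos s * Real.cos t) + Q * (Real.sin s * Real.sin t) = R

/-- The sinusoid takes the values V > R at 0 and -V < R at π, so it can pass the level R only once
in between. Eliminating W between the values at x and y reduces this to R (sin y - sin x) < V sin (y
- x), which half-angle formulas make evident. -/
theorem sinusoid_crosses_once {V W R x y : ℝ} (hV : |R| < V) (hx : 0 ≤ x) (hxy : x < y)
    (hy : y ≤ Real.pi) (h : V * Real.cos x + W * Real.sin x ≤ R) :
    V * Real.cos y + W * Real.sin y < R := by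
  obtain ⟨h1, h2⟩ := abs_lt.1 hV
  rcases hx.eq_or_lt with rfl | hx
  · simp at h; linarith
  rcases hy.eq_or_lt with rfl | hy
  · simp; linarith
  have sx : 0 < Real.sin x := Real.sin_pos_of_pos_of_lt_pi hx (by linarith)
  have sy : 0 < Real.sin y := Real.sin_pos_of_pos_of_lt_pi (by linarith) hy
  have sh : 0 < Real.sin ((y - x) / 2) :=
    Real.sin_pos_of_pos_of_lt_pi (by linarith) (by linarith)
  have e1 : Real.sin (y - x) = 2 * Real.sin ((y - x) / 2) * Real.cos ((y - x) / 2) := by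
    rw [← Real.sin_two_mul]; congr 1; ring
  have e2 : Real.sin y - Real.sin x = 2 * Real.sin ((y - x) / 2) * Real.cos ((y + x) / 2) :=
    Real.sin_sub_sin y x
  have c1 : Real.cos ((y + x) / 2) < Real.cos ((y - x) / 2) :=
    Real.cos_lt_cos_of_nonneg_of_le_pi (by linarith) (by linarith) (by linarith)
  have c2 : -Real.cos ((y + x) / 2) < Real.cos ((y - x) / 2) := by
    rw [← Real.cos_pi_sub]
    exact Real.cos_lt_cos_of_nonneg_of_le_pi (by linarith) (by linarith) (by linarith)
  have c3 : R * Real.cos ((y + x) / 2) < V * Real.cos ((y - x) / 2) := by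
    have : |Real.cos ((y + x) / 2)| < Real.cos ((y - x) / 2) := abs_lt.2 ⟨by linarith, c1⟩
    calc R * Real.cos ((y + x) / 2) ≤ |R * Real.cos ((y + x) / 2)| := le_abs_self _
      _ = |R| * |Real.cos ((y + x) / 2)| := abs_mul _ _
      _ ≤ |R| * Real.cos ((y - x) / 2) := by gcongr
      _ < V * Real.cos ((y - x) / 2) := by
        gcongr; exact (abs_nonneg _).trans_lt this
  have key : R * (Real.sin y - Real.sin x) < V * Real.sin (y - x) := by
    rw [e1, e2]; nlinarith
  rw [Real.sin_sub] at key
  have h3 := mul_le_mul_of_nonneg_right h sy.le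
  have : 0 < Real.sin x * (R - (V * Real.cos y + W * Real.sin y)) := by linarith
  linarith [pos_of_mul_pos_right this sx.le]

/-! ### Monotone symmetries of the angle correspondence -/

section Sequences

variable {P Q R : ℝ}

theorem abs_lt_diagonal (hP : |R| < P) (hQ : |R| < Q) (s : ℝ) :
    |R| < P * Real.cos s ^ 2 + Q * Real.sin s ^ 2 := by
  have h := Real.sin_sq_add_cos_sq s
  rcases (sq_nonneg (Real.cos s)).eq_or_lt with h0 | h0
  · rw [← h0] at h ⊢
    rw [show Real.sin s ^ 2 = 1 by linarith]
    linarith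
  · have h1 := mul_lt_mul_of_pos_right hP h0
    have h2 := mul_le_mul_of_nonneg_right hQ.le (sq_nonneg (Real.sin s))
    have h3 : |R| * (Real.sin s ^ 2 + Real.cos s ^ 2) = |R| := by rw [h, mul_one]
    linarith

theorem forward_crossing (hP : |R| < P) (hQ : |R| < Q) {s x y : ℝ} (hx : s ≤ x) (hxy : x < y)
    (hy : y ≤ s + Real.pi)
    (h : P * (Real.cos s * Real.cos x) + Q * (Real.sin s * Real.sin x) ≤ R) :
    P * (Real.cos s * Real.cos y) + Q * (Real.sin s * Real.sin y) < R := by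
  -- For fixed s the form is a sinusoid in z - s, whose cosine coefficient is its value on the
  -- diagonal z = s.
  have e (z : ℝ) : P * (Real.cos s * Real.cos z) + Q * (Real.sin s * Real.sin z) =
      (P * Real.cos s ^ 2 + Q * Real.sin s ^ 2) * Real.cos (z - s) +
        (Q - P) * Real.sin s * Real.cos s * Real.sin (z - s) := by
    obtain ⟨w, rfl⟩ : ∃ w, z = s + w := ⟨z - s, by ring⟩
    rw [add_sub_cancel_left, Real.cos_add, Real.sin_add]; ring
  rw [e] at h ⊢
  exact sinusoid_crosses_once (abs_lt_diagonal hP hQ s) (by linarith) (by linarith)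
    (by linarith) h

theorem backward_crossing (hP : |R| < P) (hQ : |R| < Q) {s x y : ℝ} (hx : x ≤ s) (hxy : y < x)
    (hy : s - Real.pi ≤ y)
    (h : P * (Real.cos x * Real.cos s) + Q * (Real.sin x * Real.sin s) ≤ R) :
    P * (Real.cos y * Real.cos s) + Q * (Real.sin y * Real.sin s) < R := by
  have := forward_crossing hP hQ (s := -s) (x := -x) (y := -y) (by linarith) (by linarith)
    (by linarith) (by simp only [Real.cos_neg, Real.sin_neg]; linarith)
  simp only [Real.cos_neg, Real.sin_neg] at this
  linarith

theorem IsNextAngle.unique (hP : |R| < P) (hQ : |R| < Q) {s t t' : ℝ}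
    (h : IsNextAngle P Q R s t) (h' : IsNextAngle P Q R s t') : t = t' := by
  rcases lt_trichotomy t t' with hl | he | hl
  · exact absurd h'.eq (forward_crossing hP hQ h.lt.le hl h'.lt_add_pi.le h.eq.le).ne
  · exact he
  · exact absurd h.eq (forward_crossing hP hQ h'.lt.le hl h.lt_add_pi.le h'.eq.le).ne

/-- Only the case s < t < s' needs an argument. The form at (t, s') must exceed R: otherwise moving
t back to s would bring it strictly below R at (s, s'). But if t' ≤ s', moving t' forward to s'
makes it at most R. -/
theorem IsNextAngle.lt_of_lt (hP : |R| < P) (hQ : |R| < Q) {s s' t t' : ℝ}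
    (h : IsNextAngle P Q R s s') (h' : IsNextAngle P Q R t t') (hst : s < t) : s' < t' := by
  rcases le_or_gt s' t with h0 | h0
  · exact h0.trans_lt h'.lt
  by_contra! hle
  have h1 : R < P * (Real.cos t * Real.cos s') + Q * (Real.sin t * Real.sin s') := by
    by_contra! hc
    exact absurd h.eq
      (backward_crossing hP hQ h0.le hst (by linarith [h.lt_add_pi]) hc).ne
  rcases hle.eq_or_lt with he | hl
  · rw [← he, h'.eq] at h1
    exact h1.false
  · exact absurd h1
      (forward_crossing hP hQ h'.lt.le hl (by linarith [h.lt_add_pi]) h'.eq.le).not_gt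

/-- A monotone symmetry `g` of the angle correspondence moves a solution `t` by `m` steps as soon
as `g^[q]` moves its initial value by `q * m` steps. -/
theorem shift_eq_of_iterate_eq (hP : |R| < P) (hQ : |R| < Q) {t : ℕ → ℝ}
    (ht : ∀ i, IsNextAngle P Q R (t i) (t (i + 1))) {g : ℝ → ℝ} (hg : StrictMono g)
    (hgn : ∀ s u, IsNextAngle P Q R s u → IsNextAngle P Q R (g s) (g u)) {q m : ℕ} (hq : 0 < q)
    (h : t (q * m) = g^[q] (t 0)) (i : ℕ) : t (i + m) = g (t i) := by
  have h1 (i : ℕ) : IsNextAngle P Q R (t (i + m)) (t (i + 1 + m)) := by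
    have := ht (i + m)
    rwa [add_right_comm] at this
  have h2 (i : ℕ) : IsNextAngle P Q R (g (t i)) (g (t (i + 1))) := hgn _ _ (ht i)
  obtain ⟨q, rfl⟩ : ∃ r, q = r + 1 := ⟨q - 1, by omega⟩
  -- Rotation-number argument: a strict inequality between t m and g (t 0) persists along the orbit
  -- by monotonicity, and q applications of it contradict `h`.
  have h0 : t (0 + m) = g (t 0) := by
    rcases lt_trichotomy (t (0 + m)) (g (t 0)) with hl | he | hl
    · have hall (i : ℕ) : t (i + m) < g (t i) := by
        induction i with
        | zero => exact hl
        | succ i ih => exact (h1 i).lt_of_lt hP hQ (h2 i) ih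
      have hit (j : ℕ) : t ((j + 1) * m) < g^[j + 1] (t 0) := by
        induction j with
        | zero => simpa using hl
        | succ j ih =>
          rw [Function.iterate_succ_apply', add_mul, one_mul]
          exact (hall _).trans (hg ih)
      exact absurd h (hit q).ne
    · exact he
    · have hall (i : ℕ) : g (t i) < t (i + m) := by
        induction i with
        | zero => exact hl
        | succ i ih => exact (h2 i).lt_of_lt hP hQ (h1 i) ih
      have hit (j : ℕ) : g^[j + 1] (t 0) < t ((j + 1) * m) := by
        induction j with
        | zero => simpa using hl
        | succ j ih =>
          rw [Function.iterate_succ_apply', add_mul, one_mul]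
          exact (hg ih).trans (hall _)
      exact absurd h (hit q).ne'
  induction i with
  | zero => exact h0
  | succ i ih => exact (h1 i).unique hP hQ (ih ▸ h2 i)

theorem IsNextAngle.add_pi {s t : ℝ} (h : IsNextAngle P Q R s t) :
    IsNextAngle P Q R (s + Real.pi) (t + Real.pi) :=
  ⟨by linarith [h.lt], by linarith [h.lt_add_pi], by
    simp only [Real.cos_add_pi, Real.sin_add_pi]; linarith [h.eq]⟩

theorem IsNextAngle.iterate {g : ℝ → ℝ}
    (hg : ∀ s u, IsNextAngle P Q R s u → IsNextAngle P Q R (g s) (g u)) (k : ℕ) {s u : ℝ}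
    (h : IsNextAngle P Q R s u) : IsNextAngle P Q R (g^[k] s) (g^[k] u) := by
  induction k with
  | zero => exact h
  | succ k ih =>
    rw [Function.iterate_succ_apply', Function.iterate_succ_apply']
    exact hg _ _ ih

theorem shift_eq_iterate (hP : |R| < P) (hQ : |R| < Q) {t : ℕ → ℝ}
    (ht : ∀ i, IsNextAngle P Q R (t i) (t (i + 1))) {g : ℝ → ℝ} (hg : StrictMono g)
    (hgn : ∀ s u, IsNextAngle P Q R s u → IsNextAngle P Q R (g s) (g u)) {q m k : ℕ} (hq : 0 < q)
    (hgq : ∀ x, g^[q] x = x + 2 * Real.pi)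
    (h : t (q * m) = t 0 + k * (2 * Real.pi)) (i : ℕ) : t (i + m) = g^[k] (t i) := by
  refine shift_eq_of_iterate_eq hP hQ ht (hg.iterate k)
    (fun _ _ => IsNextAngle.iterate hgn k) hq ?_ i
  have e : g^[q] = fun x => x + 2 * Real.pi := funext hgq
  rw [h, ← Function.iterate_mul, mul_comm k q, Function.iterate_mul, e, add_right_iterate]
  simp

end Sequences

/-! ### The quarter-period shift -/

section QuarterShift

variable {a b : ℝ}

/-- `√(b² cos² t + a² sin² t)`, the distance from `0` to the point of the ellipse with semi-axes
`b`, `a` at the angle `t`. -/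
noncomputable def conjugateRadius (a b t : ℝ) : ℝ := √(b ^ 2 * Real.cos t ^ 2 + a ^ 2 * Real.sin t ^ 2)

theorem conjugateRadius_arg_pos (ha : 0 < a) (hb : 0 < b) (t : ℝ) :
    0 < b ^ 2 * Real.cos t ^ 2 + a ^ 2 * Real.sin t ^ 2 := by
  have h := Real.sin_sq_add_cos_sq t
  rcases (sq_nonneg (Real.cos t)).eq_or_lt with h0 | h0
  · rw [← h0] at h ⊢
    have : Real.sin t ^ 2 = 1 := by linarith
    rw [this]; positivity
  · positivity

theorem conjugateRadius_pos (ha : 0 < a) (hb : 0 < b) (t : ℝ) : 0 < conjugateRadius a b t :=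
  Real.sqrt_pos.2 (conjugateRadius_arg_pos ha hb t)

theorem conjugateRadius_sq (a b t : ℝ) :
    conjugateRadius a b t ^ 2 = b ^ 2 * Real.cos t ^ 2 + a ^ 2 * Real.sin t ^ 2 :=
  Real.sq_sqrt (by positivity)

/-- The lift to angles of the map `(x, y) ↦ (-a y, b x) / √(b² x² + a² y²)` of the unit circle
(the translation by a quarter period, in terms of elliptic functions). -/
noncomputable def quarterShift (a b t : ℝ) : ℝ :=
  t + Real.pi / 2 + Real.arctan ((a - b) * Real.sin t * Real.cos t /
    (b * Real.cos t ^ 2 + a * Real.sin t ^ 2))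

theorem lt_quarterShift (a b t : ℝ) : t < quarterShift a b t := by
  unfold quarterShift
  linarith [Real.neg_pi_div_two_lt_arctan ((a - b) * Real.sin t * Real.cos t /
    (b * Real.cos t ^ 2 + a * Real.sin t ^ 2))]

theorem quarterShift_lt (a b t : ℝ) : quarterShift a b t < t + Real.pi := by
  unfold quarterShift
  linarith [Real.arctan_lt_pi_div_two ((a - b) * Real.sin t * Real.cos t /
    (b * Real.cos t ^ 2 + a * Real.sin t ^ 2))]

theorem quarterShift_add_pi (a b t : ℝ) :
    quarterShift a b (t + Real.pi) = quarterShift a b t + Real.pi := by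
  simp only [quarterShift, Real.sin_add_pi, Real.cos_add_pi]
  ring_nf

/-- The arctangent is the angle from (-sin t, cos t) to (-a sin t, b cos t): their cross product is
W and their scalar product is N > 0, so no branch of the angle is missed. -/
theorem cos_sin_quarterShift (ha : 0 < a) (hb : 0 < b) (t : ℝ) :
    Real.cos (quarterShift a b t) = -a * Real.sin t / conjugateRadius a b t ∧
    Real.sin (quarterShift a b t) = b * Real.cos t / conjugateRadius a b t := by
  have h1 := Real.sin_sq_add_cos_sq t
  have hD := conjugateRadius_pos ha hb t
  have hD2 := conjugateRadius_sq a b t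
  set D := conjugateRadius a b t
  have hN : 0 < b * Real.cos t ^ 2 + a * Real.sin t ^ 2 := by
    have := conjugateRadius_arg_pos (Real.sqrt_pos.2 ha) (Real.sqrt_pos.2 hb) t
    rwa [Real.sq_sqrt ha.le, Real.sq_sqrt hb.le] at this
  set N := b * Real.cos t ^ 2 + a * Real.sin t ^ 2 with hNdef
  set W := (a - b) * Real.sin t * Real.cos t with hW
  have e : 1 + (W / N) ^ 2 = (D / N) ^ 2 := by
    field_simp
    rw [hD2, hW, hNdef]
    linear_combination (-(b ^ 2 * Real.cos t ^ 2 + a ^ 2 * Real.sin t ^ 2)) * (-h1)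
  have hc : Real.cos (Real.arctan (W / N)) = N / D := by
    rw [Real.cos_arctan, e, Real.sqrt_sq (by positivity)]; field_simp
  have hs : Real.sin (Real.arctan (W / N)) = W / D := by
    rw [Real.sin_arctan, e, Real.sqrt_sq (by positivity)]; field_simp
  unfold quarterShift
  rw [Real.cos_add, Real.sin_add (t + Real.pi / 2), Real.cos_add_pi_div_two,
    Real.sin_add_pi_div_two, hc, hs]
  constructor
  · field_simp
    rw [hW, hNdef]
    linear_combination (-a * Real.sin t) * h1
  · field_simp
    rw [hW, hNdef]
    linear_combination (b * Real.cos t) * h1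

/-- The underlying map is linear of determinant ab > 0 followed by normalization, so it preserves
the sign of sin (t - s). The bounds t < g t < t + π turn this into an inequality of lifted angles.
-/
theorem quarterShift_strictMono (ha : 0 < a) (hb : 0 < b) : StrictMono (quarterShift a b) := by
  intro s t hst
  have s1 := lt_quarterShift a b s
  have s2 := quarterShift_lt a b s
  have t1 := lt_quarterShift a b t
  have t2 := quarterShift_lt a b t
  rcases le_or_gt (s + Real.pi) t with h | h
  · linarith
  have hsin : 0 < Real.sin (t - s) := Real.sin_pos_of_pos_of_lt_pi (by linarith) (by linarith)
  have hDs := conjugateRadius_pos ha hb s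
  have hDt := conjugateRadius_pos ha hb t
  have e : Real.sin (quarterShift a b t - quarterShift a b s) =
      a * b * Real.sin (t - s) / (conjugateRadius a b s * conjugateRadius a b t) := by
    rw [Real.sin_sub, (cos_sin_quarterShift ha hb s).1, (cos_sin_quarterShift ha hb s).2,
      (cos_sin_quarterShift ha hb t).1, (cos_sin_quarterShift ha hb t).2, Real.sin_sub]
    field_simp
    ring
  have hpos : 0 < Real.sin (quarterShift a b t - quarterShift a b s) := by
    rw [e]; positivity
  by_contra! hle
  exact absurd hpos
    (Real.sin_nonpos_of_nonpos_of_neg_pi_le (by linarith) (by linarith)).not_gt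

theorem conjugateRadius_mul_quarterShift (ha : 0 < a) (hb : 0 < b) (t : ℝ) :
    conjugateRadius a b t * conjugateRadius a b (quarterShift a b t) = a * b := by
  have h1 := conjugateRadius_pos ha hb t
  have h2 := conjugateRadius_pos ha hb (quarterShift a b t)
  rw [← sq_eq_sq₀ (by positivity) (by positivity), mul_pow,
    conjugateRadius_sq a b (quarterShift _ _ _), (cos_sin_quarterShift ha hb t).1, (cos_sin_quarterShift ha hb t).2]
  field_simp
  linear_combination Real.sin_sq_add_cos_sq t

theorem quarterShift_quarterShift (ha : 0 < a) (hb : 0 < b) (t : ℝ) :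
    quarterShift a b (quarterShift a b t) = t + Real.pi := by
  have h0 := conjugateRadius_mul_quarterShift ha hb t
  have h1 := conjugateRadius_pos ha hb t
  have h2 := conjugateRadius_pos ha hb (quarterShift a b t)
  -- The two angles agree modulo 2π; the a priori bounds on the shift exclude every multiple except
  -- zero.
  have hc : Real.cos (quarterShift a b (quarterShift a b t) - t - Real.pi) = 1 := by
    rw [Real.cos_sub_pi, Real.cos_sub, (cos_sin_quarterShift ha hb (quarterShift a b t)).1,
      (cos_sin_quarterShift ha hb (quarterShift a b t)).2, (cos_sin_quarterShift ha hb t).1,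
      (cos_sin_quarterShift ha hb t).2]
    field_simp
    linear_combination (a * b) * Real.sin_sq_add_cos_sq t - h0
  have b1 := lt_quarterShift a b t
  have b2 := lt_quarterShift a b (quarterShift a b t)
  have b3 := quarterShift_lt a b t
  have b4 := quarterShift_lt a b (quarterShift a b t)
  have := (Real.cos_eq_one_iff_of_lt_of_lt (by linarith) (by linarith)).1 hc
  linarith

theorem quarterShift_iterate_four (ha : 0 < a) (hb : 0 < b) (t : ℝ) :
    (quarterShift a b)^[4] t = t + 2 * Real.pi := by
  simp only [Function.iterate_succ, Function.iterate_zero, Function.comp_apply, id]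
  rw [quarterShift_quarterShift ha hb, quarterShift_quarterShift ha hb]
  ring

theorem IsNextAngle.map_quarterShift {P Q R : ℝ} (hb : 0 < b) (hab : b < a) (hP : |R| < P)
    (hQ : |R| < Q) (hPQR : R ^ 2 * (a ^ 2 - b ^ 2) = P ^ 2 * a ^ 2 - Q ^ 2 * b ^ 2) {s t : ℝ}
    (h : IsNextAngle P Q R s t) :
    IsNextAngle P Q R (quarterShift a b s) (quarterShift a b t) := by
  have ha : 0 < a := hb.trans hab
  refine ⟨quarterShift_strictMono ha hb h.lt, ?_, ?_⟩
  · rw [← quarterShift_add_pi]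
    exact quarterShift_strictMono ha hb h.lt_add_pi
  have hs := Real.sin_sq_add_cos_sq s
  have ht := Real.sin_sq_add_cos_sq t
  have hXY := h.eq
  have hDs := conjugateRadius_pos ha hb s
  have hDt := conjugateRadius_pos ha hb t
  have hDs2 := conjugateRadius_sq a b s
  have hDt2 := conjugateRadius_sq a b t
  rw [(cos_sin_quarterShift ha hb s).1, (cos_sin_quarterShift ha hb s).2,
    (cos_sin_quarterShift ha hb t).1, (cos_sin_quarterShift ha hb t).2]
  have hX1 : |Real.cos s * Real.cos t| ≤ 1 := by
    rw [abs_mul]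
    exact mul_le_one₀ (Real.abs_cos_le_one s) (abs_nonneg _) (Real.abs_cos_le_one t)
  have hw2 : (conjugateRadius a b s * conjugateRadius a b t) ^ 2 =
      b ^ 4 * (Real.cos s * Real.cos t) ^ 2 + a ^ 4 * (Real.sin s * Real.sin t) ^ 2 +
      a ^ 2 * b ^ 2 * (1 - (Real.cos s * Real.cos t) ^ 2 - (Real.sin s * Real.sin t) ^ 2) := by
    rw [mul_pow, hDs2, hDt2]
    linear_combination (a ^ 2 * b ^ 2) * (Real.sin t ^ 2 + Real.cos t ^ 2) * hs + a ^ 2 * b ^ 2 * ht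
  have hw : 0 < conjugateRadius a b s * conjugateRadius a b t := by positivity
  have goal_eq : P * (-a * Real.sin s / conjugateRadius a b s *
        (-a * Real.sin t / conjugateRadius a b t)) +
      Q * (b * Real.cos s / conjugateRadius a b s * (b * Real.cos t / conjugateRadius a b t)) =
      (P * a ^ 2 * (Real.sin s * Real.sin t) + Q * b ^ 2 * (Real.cos s * Real.cos t)) /
        (conjugateRadius a b s * conjugateRadius a b t) := by
    field_simp
  rw [goal_eq, div_eq_iff hw.ne']
  set X := Real.cos s * Real.cos t
  set Y := Real.sin s * Real.sin t
  set w := conjugateRadius a b s * conjugateRadius a b t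
  -- Confocality, in the form `hPQR`, yields the transformed relation only up to sign. The wrong
  -- sign would give P a² + w Q ≤ |R| (a² - b²), impossible since |R| < P and w Q > 0.
  have hsq : (P * a ^ 2 * Y + Q * b ^ 2 * X) ^ 2 = (R * w) ^ 2 := by
    rw [mul_pow, hw2]
    have : R ^ 2 = (P * X + Q * Y) ^ 2 := by rw [hXY]
    linear_combination (-(a ^ 2 * b ^ 2)) * this + (b ^ 2 * X ^ 2 - a ^ 2 * Y ^ 2) * hPQR
  rcases sq_eq_sq_iff_eq_or_eq_neg.1 hsq with h0 | h0
  · exact h0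
  rcases eq_or_ne R 0 with rfl | hR
  · linarith
  exfalso
  have hX : R * (a ^ 2 - b ^ 2) * X = P * a ^ 2 + w * Q := by
    apply mul_left_cancel₀ hR
    linear_combination X * hPQR + P * a ^ 2 * hXY - Q * h0
  have hpos : 0 < a ^ 2 - b ^ 2 := by nlinarith
  have hR0 := abs_nonneg R
  have : |R * (a ^ 2 - b ^ 2) * X| ≤ |R| * (a ^ 2 - b ^ 2) := by
    rw [abs_mul, abs_mul, abs_of_pos hpos]
    exact mul_le_of_le_one_right (by positivity) hX1
  have h3 := (le_abs_self _).trans this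
  rw [hX] at h3
  have : 0 < w * Q := mul_pos hw (by linarith)
  nlinarith [mul_pos ha ha, mul_pos hb hb]

end QuarterShift

/-! ### From the billiard polygon to tangency angles -/

section Geometry

theorem inner_plane (u v : Plane) : inner ℝ u v = u 0 * v 0 + u 1 * v 1 := by
  simp [PiLp.inner_apply, Fin.sum_univ_two, mul_comm]

theorem norm_plane_sq (u : Plane) : ‖u‖ ^ 2 = u 0 ^ 2 + u 1 ^ 2 := by
  rw [← real_inner_self_eq_norm_sq, inner_plane]; ring

theorem plane_ext {u v : Plane} (h0 : u 0 = v 0) (h1 : u 1 = v 1) : u = v := by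
  ext i; fin_cases i <;> assumption

theorem eq_zero_of_sq_add_sq_eq_zero {u v : ℝ} (h : u ^ 2 + v ^ 2 = 0) : u = 0 ∧ v = 0 := by
  constructor <;> nlinarith [sq_nonneg u, sq_nonneg v]

theorem mem_ellipseTangentLine {p q : ℝ} {T : Plane} (hT : T ∈ ellipse p q) (X : Plane) :
    X ∈ ellipseTangentLine p q T ↔ T 0 / p ^ 2 * X 0 + T 1 / q ^ 2 * X 1 = 1 := by
  have hT' : T 0 ^ 2 / p ^ 2 + T 1 ^ 2 / q ^ 2 = 1 := hT
  rw [ellipseTangentLine, AffineSubspace.mem_mk', tangentDirection,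
    Submodule.mem_orthogonal_singleton_iff_inner_right, inner_plane]
  simp only [ellipseNormal, vsub_eq_sub, PiLp.sub_apply, Matrix.cons_val_zero, Matrix.cons_val_one,
    Matrix.cons_val_fin_one]
  constructor <;> intro h
  · linear_combination h + hT'
  · linear_combination h - hT'

theorem dist_foot_of_eq_tangentLine {p q : ℝ} {T : Plane} (hT : T ∈ ellipse p q)
    {l : AffineSubspace ℝ Plane} [Nonempty l] (hl : l = ellipseTangentLine p q T) (X : Plane) :
    dist X (EuclideanGeometry.orthogonalProjection l X) =
      |T 0 / p ^ 2 * X 0 + T 1 / q ^ 2 * X 1 - 1| /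
        √((T 0 / p ^ 2) ^ 2 + (T 1 / q ^ 2) ^ 2) := by
  have hR := EuclideanGeometry.orthogonalProjection_mem (s := l) X
  have hd := EuclideanGeometry.vsub_orthogonalProjection_mem_direction_orthogonal l X
  set Y : Plane := ↑(EuclideanGeometry.orthogonalProjection l X)
  rw [hl, mem_ellipseTangentLine hT] at hR
  rw [hl, ellipseTangentLine, AffineSubspace.direction_mk', tangentDirection,
    Submodule.orthogonal_orthogonal, Submodule.mem_span_singleton] at hd
  obtain ⟨κ, hκ⟩ := hd
  have hT' : T 0 ^ 2 / p ^ 2 + T 1 ^ 2 / q ^ 2 = 1 := hT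
  have hN : ‖ellipseNormal p q T‖ = √((T 0 / p ^ 2) ^ 2 + (T 1 / q ^ 2) ^ 2) := by
    rw [← Real.sqrt_sq (norm_nonneg _), norm_plane_sq]; simp [ellipseNormal]
  have h0 : κ * (T 0 / p ^ 2) = X 0 - Y 0 := by simpa [ellipseNormal] using congrArg (· 0) hκ
  have h1 : κ * (T 1 / q ^ 2) = X 1 - Y 1 := by simpa [ellipseNormal] using congrArg (· 1) hκ
  have hpos : 0 < (T 0 / p ^ 2) ^ 2 + (T 1 / q ^ 2) ^ 2 := by
    by_contra! hle
    obtain ⟨z0, z1⟩ := eq_zero_of_sq_add_sq_eq_zero (le_antisymm hle (by positivity))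
    rw [z0, z1] at hR
    simp at hR
  rw [dist_eq_norm, ← vsub_eq_sub, ← hκ, norm_smul, hN, Real.norm_eq_abs,
    eq_div_iff (Real.sqrt_pos.2 hpos).ne', mul_assoc, Real.mul_self_sqrt hpos.le]
  have e : T 0 / p ^ 2 * X 0 + T 1 / q ^ 2 * X 1 - 1 =
      κ * ((T 0 / p ^ 2) ^ 2 + (T 1 / q ^ 2) ^ 2) := by
    linear_combination hR - T 0 / p ^ 2 * h0 - T 1 / q ^ 2 * h1
  rw [e, abs_mul, abs_of_pos hpos]

theorem reflection_tangentDirection (p q : ℝ) (X v : Plane) :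
    (tangentDirection p q X).reflection v =
      v - (2 / ‖ellipseNormal p q X‖ ^ 2 * inner ℝ (ellipseNormal p q X) v) •
        ellipseNormal p q X := by
  rw [tangentDirection, Submodule.reflection_orthogonal_apply, Submodule.reflection_singleton_apply,
    RCLike.ofReal_real_eq_id, id, ← Nat.cast_smul_eq_nsmul ℝ, smul_smul, neg_sub]
  congr 2
  push_cast
  ring

/-- No normal line of an ellipse is tangent to a confocal ellipse. -/
theorem normal_line_not_tangent {a b A B : ℝ} (hb : 0 < b) (hab : b < a) (hA : 0 < A)
    (hB : 0 < B) (hconfocal : A ^ 2 - B ^ 2 = a ^ 2 - b ^ 2) {x y p q : ℝ}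
    (hE : x ^ 2 / A ^ 2 + y ^ 2 / B ^ 2 = 1) (htan : a ^ 2 * p ^ 2 + b ^ 2 * q ^ 2 = 1)
    (hmem : p * x + q * y = 1) (hdir : p * (x / A ^ 2) + q * (y / B ^ 2) = 0) : False := by
  have ha : 0 < a := hb.trans hab
  have hu : (a ^ 2 - b ^ 2) * (p * (x / A)) = A := by
    rw [← hconfocal]
    field_simp at hdir ⊢
    linear_combination (-1) * hdir + A ^ 2 * hmem
  have hw : (a ^ 2 - b ^ 2) * (q * (y / B)) = -B := by
    rw [← hconfocal]
    field_simp at hdir ⊢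
    linear_combination hdir - B ^ 2 * hmem
  have hE' : (x / A) ^ 2 + (y / B) ^ 2 = 1 := by rw [div_pow, div_pow, hE]
  -- Cauchy–Schwarz for (ap, bq) and (x/A, -y/B). With `hu` and `hw` it gives aA + bB ≤ a² - b²,
  -- while confocality gives (a² - b²)² = (a² - b²)(A² - B²) < (aA)².
  have cs : (a * (p * (x / A)) - b * (q * (y / B))) ^ 2 ≤ 1 := by
    have : (a * (p * (x / A)) - b * (q * (y / B))) ^ 2 + (a * p * (y / B) + b * q * (x / A)) ^ 2
        = (a ^ 2 * p ^ 2 + b ^ 2 * q ^ 2) * ((x / A) ^ 2 + (y / B) ^ 2) := by ring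
    rw [htan, hE'] at this
    nlinarith [sq_nonneg (a * p * (y / B) + b * q * (x / A))]
  have hc : 0 < a ^ 2 - b ^ 2 := by nlinarith
  have h1 : (a * A + b * B) ^ 2 ≤ (a ^ 2 - b ^ 2) ^ 2 := by
    have e : a * A + b * B = (a ^ 2 - b ^ 2) * (a * (p * (x / A)) - b * (q * (y / B))) := by
      linear_combination (-a) * hu + b * hw
    rw [e, mul_pow]
    exact mul_le_of_le_one_right (by positivity) cs
  have h2 : (a ^ 2 - b ^ 2) ^ 2 < (a * A) ^ 2 := by
    have : (a ^ 2 - b ^ 2) ^ 2 = (a ^ 2 - b ^ 2) * (A ^ 2 - B ^ 2) := by rw [hconfocal]; ring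
    rw [this, mul_pow]
    exact mul_lt_mul'' (by nlinarith) (by nlinarith) hc.le (by linarith)
  nlinarith [mul_pos ha hA, mul_pos hb hB]

/-- Consecutive sides of a billiard polygon touch a confocal ellipse at distinct points. -/
theorem tangency_points_ne {a b A B : ℝ} (hb : 0 < b) (hab : b < a) (hA : 0 < A)
    (hB : 0 < B) (hconfocal : A ^ 2 - B ^ 2 = a ^ 2 - b ^ 2) {M : ℕ → Plane}
    (hM : IsBilliardTrajectory A B M) {i : ℕ} {T T' : Plane} (hT : T ∈ ellipse a b)
    (hl : sideLine M i = ellipseTangentLine a b T)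
    (hl' : sideLine M (i + 1) = ellipseTangentLine a b T') : T ≠ T' := by
  rintro rfl
  have ha : 0 < a := hb.trans hab
  have m0 : M i ∈ sideLine M i := left_mem_affineSpan_pair ℝ _ _
  have m1 : M (i + 1) ∈ sideLine M i := right_mem_affineSpan_pair ℝ _ _
  have m2 : M (i + 2) ∈ sideLine M (i + 1) := right_mem_affineSpan_pair ℝ _ _
  rw [hl, mem_ellipseTangentLine hT] at m0 m1
  rw [hl', mem_ellipseTangentLine hT] at m2
  have hT' : T 0 ^ 2 / a ^ 2 + T 1 ^ 2 / b ^ 2 = 1 := hT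
  have E0 : M i 0 ^ 2 / A ^ 2 + M i 1 ^ 2 / B ^ 2 = 1 := hM.mem_ellipse i
  have E1 : M (i + 1) 0 ^ 2 / A ^ 2 + M (i + 1) 1 ^ 2 / B ^ 2 = 1 := hM.mem_ellipse (i + 1)
  have hne := hM.ne_succ i
  have hrefl := hM.reflection_law i
  rw [reflection_tangentDirection] at hrefl
  have hκ : 2 / ‖ellipseNormal A B (M (i + 1))‖ ^ 2 ≠ 0 := by
    have hN : ‖ellipseNormal A B (M (i + 1))‖ ^ 2 ≠ 0 := by
      rw [norm_plane_sq]
      intro h0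
      simp only [ellipseNormal, Matrix.cons_val_zero, Matrix.cons_val_one,
        Matrix.cons_val_fin_one] at h0
      obtain ⟨z0, z1⟩ := eq_zero_of_sq_add_sq_eq_zero h0
      have : M (i + 1) 0 * (M (i + 1) 0 / A ^ 2) + M (i + 1) 1 * (M (i + 1) 1 / B ^ 2) = 1 := by
        rw [← E1]; ring
      rw [z0, z1] at this
      simp at this
    exact div_ne_zero two_ne_zero hN
  generalize 2 / ‖ellipseNormal A B (M (i + 1))‖ ^ 2 = κ at hκ hrefl
  set n0 := T 0 / a ^ 2
  set n1 := T 1 / b ^ 2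
  have hr : ‖M (i + 1) - M i‖⁻¹ ≠ 0 := inv_ne_zero (norm_ne_zero_iff.2 (sub_ne_zero.2 hne.symm))
  set N0 := M (i + 1) 0 / A ^ 2 with hN0
  set N1 := M (i + 1) 1 / B ^ 2 with hN1
  have c0 := congrArg (· 0) hrefl
  have c1 := congrArg (· 1) hrefl
  simp only [unitDirection, ellipseNormal, inner_plane, PiLp.sub_apply, PiLp.smul_apply,
    smul_eq_mul, Matrix.cons_val_zero, Matrix.cons_val_one, Matrix.cons_val_fin_one] at c0 c1
  rw [← hN0, ← hN1] at c0 c1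
  set ρ := ‖M (i + 1) - M i‖⁻¹
  set σ := ‖M (i + 2) - M (i + 1)‖⁻¹
  clear_value ρ σ N0 N1
  -- If both sides lay on one line with normal n, pairing the reflection law with n would leave this
  -- product. Its vanishing makes the side tangent to E, so that its endpoints coincide, or normal
  -- to E.
  have key : κ * (ρ * (N0 * (M (i + 1) 0 - M i 0) + N1 * (M (i + 1) 1 - M i 1)) *
      (n0 * N0 + n1 * N1)) = 0 := by
    clear_value n0 n1
    linear_combination n0 * c0 + n1 * c1 - σ * (m2 - m1) + ρ * (m1 - m0)
  rcases mul_eq_zero.1 ((mul_eq_zero.1 key).resolve_left hκ) with h0 | h0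
  · have h0 := (mul_eq_zero.1 h0).resolve_left hr
    have : ((M (i + 1) 0 - M i 0) / A) ^ 2 + ((M (i + 1) 1 - M i 1) / B) ^ 2 = 0 := by
      rw [hN0, hN1] at h0
      rw [div_pow, div_pow]
      linear_combination 2 * h0 + E0 - E1
    obtain ⟨z0, z1⟩ := eq_zero_of_sq_add_sq_eq_zero this
    rw [div_eq_zero_iff, or_iff_left hA.ne', sub_eq_zero] at z0
    rw [div_eq_zero_iff, or_iff_left hB.ne', sub_eq_zero] at z1
    exact hne (plane_ext z0.symm z1.symm)
  · rw [hN0, hN1] at h0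
    refine normal_line_not_tangent hb hab hA hB hconfocal E1 ?_ m1 h0
    rw [← hT']
    simp only [n0, n1]
    field_simp

/-- In coordinates where γ is the unit circle, the vertex between two sides is at the same signed
tangent length μ from both points of tangency, so the angle advances by 2 arctan μ, which lies in
(0, π). Summing these increments gives the lift directly. -/
theorem exists_angle_seq {α β : ℝ} {e₀ e₁ μ : ℕ → ℝ} (he : ∀ i, e₀ i ^ 2 + e₁ i ^ 2 = 1)
    (hμ : ∀ i, 0 < μ i)
    (h₀ : ∀ i, e₀ i - μ i * e₁ i = e₀ (i + 1) + μ i * e₁ (i + 1))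
    (h₁ : ∀ i, e₁ i + μ i * e₀ i = e₁ (i + 1) - μ i * e₀ (i + 1))
    (hE : ∀ i, α * (e₀ i - μ i * e₁ i) ^ 2 + β * (e₁ i + μ i * e₀ i) ^ 2 = 1) :
    ∃ t : ℕ → ℝ, (∀ i, e₀ i = Real.cos (t i) ∧ e₁ i = Real.sin (t i)) ∧
      ∀ i, IsNextAngle (1 - α + β) (1 + α - β) (α + β - 1) (t i) (t (i + 1)) := by
  obtain ⟨t₀, h00, h01⟩ : ∃ t₀, e₀ 0 = Real.cos t₀ ∧ e₁ 0 = Real.sin t₀ := by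
    have hz : ‖(⟨e₀ 0, e₁ 0⟩ : ℂ)‖ = 1 := by
      rw [Complex.norm_def, Complex.normSq_mk, ← sq, ← sq, he, Real.sqrt_one]
    have hz0 : (⟨e₀ 0, e₁ 0⟩ : ℂ) ≠ 0 := norm_ne_zero_iff.1 (by rw [hz]; exact one_ne_zero)
    exact ⟨Complex.arg ⟨e₀ 0, e₁ 0⟩, by rw [Complex.cos_arg hz0, hz, div_one],
      by rw [Complex.sin_arg, hz, div_one]⟩
  let t : ℕ → ℝ := fun i => t₀ + ∑ j ∈ Finset.range i, 2 * Real.arctan (μ j)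
  have ht (i : ℕ) : t (i + 1) = t i + 2 * Real.arctan (μ i) := by
    simp only [t, Finset.sum_range_succ, add_assoc]
  have hpos (i : ℕ) : 0 < 1 + μ i ^ 2 := by positivity
  have hc (i : ℕ) : Real.cos (2 * Real.arctan (μ i)) = (1 - μ i ^ 2) / (1 + μ i ^ 2) := by
    have := hpos i
    rw [Real.cos_two_mul, Real.cos_sq_arctan]; field_simp; ring
  have hs (i : ℕ) : Real.sin (2 * Real.arctan (μ i)) = 2 * μ i / (1 + μ i ^ 2) := by
    have := hpos i
    rw [Real.sin_two_mul, Real.sin_arctan, Real.cos_arctan]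
    field_simp
    rw [Real.sq_sqrt this.le]
  have e0 (i : ℕ) : e₀ (i + 1) * (1 + μ i ^ 2) = e₀ i * (1 - μ i ^ 2) - e₁ i * (2 * μ i) := by
    linear_combination -h₀ i + μ i * h₁ i
  have e1 (i : ℕ) : e₁ (i + 1) * (1 + μ i ^ 2) = e₁ i * (1 - μ i ^ 2) + e₀ i * (2 * μ i) := by
    linear_combination -h₁ i - μ i * h₀ i
  have hcs (i : ℕ) : e₀ i = Real.cos (t i) ∧ e₁ i = Real.sin (t i) := by
    induction i with
    | zero => simpa [t] using ⟨h00, h01⟩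
    | succ i ih =>
      have := hpos i
      rw [ht, Real.cos_add, Real.sin_add (t i), hc, hs, ← ih.1, ← ih.2]
      constructor
      · field_simp; linear_combination e0 i
      · field_simp; linear_combination e1 i
  refine ⟨t, hcs, fun i => ⟨?_, ?_, ?_⟩⟩
  · rw [ht]; linarith [Real.arctan_pos.2 (hμ i)]
  · rw [ht]; linarith [Real.arctan_lt_pi_div_two (μ i)]
  · rw [← (hcs i).1, ← (hcs i).2, ← (hcs (i + 1)).1, ← (hcs (i + 1)).2]
    apply mul_right_cancel₀ (hpos i).ne'
    linear_combination (1 - α + β) * e₀ i * e0 i + (1 + α - β) * e₁ i * e1 i - 2 * hE i +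
      ((α + β) * (1 + μ i ^ 2) + (1 - μ i ^ 2)) * he i

/-- μ and -ν are the two roots of the quadratic for the intersections of the tangent with E. The
point of tangency is inside E, so their product is negative. -/
theorem tangent_lengths_mul_pos {α β e₀ e₁ μ ν : ℝ} (hα : 0 < α) (hα1 : α < 1) (hβ : 0 < β)
    (hβ1 : β < 1) (he : e₀ ^ 2 + e₁ ^ 2 = 1)
    (h : α * (e₀ - μ * e₁) ^ 2 + β * (e₁ + μ * e₀) ^ 2 = 1)
    (h' : α * (e₀ + ν * e₁) ^ 2 + β * (e₁ - ν * e₀) ^ 2 = 1) (hne : μ + ν ≠ 0) : 0 < ν * μ := by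
  have hS : 0 < α * e₁ ^ 2 + β * e₀ ^ 2 := by
    rcases (sq_nonneg e₀).eq_or_lt with h0 | h0
    · rw [← h0] at he ⊢
      rw [show e₁ ^ 2 = 1 by linarith]; linarith
    · positivity
  have hC : α * e₀ ^ 2 + β * e₁ ^ 2 < 1 := by
    have : 0 < (1 - α) * e₀ ^ 2 + (1 - β) * e₁ ^ 2 := by
      have : 0 < 1 - α := by linarith
      have : 0 < 1 - β := by linarith
      rcases (sq_nonneg e₀).eq_or_lt with h0 | h0
      · rw [← h0] at he ⊢
        rw [show e₁ ^ 2 = 1 by linarith]; linarith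
      · positivity
    linarith
  have key : (α * e₁ ^ 2 + β * e₀ ^ 2) * (ν * μ) = 1 - (α * e₀ ^ 2 + β * e₁ ^ 2) := by
    apply mul_right_cancel₀ hne
    linear_combination ν * h + μ * h'
  exact pos_of_mul_pos_right (by rw [key]; linarith) hS.le

/-- The points of tangency of the sides of a billiard polygon with a confocal ellipse, in terms
of angles which increase along the polygon, up to a reflection in the major axis. -/
theorem exists_tangency_angles {a b A B : ℝ} (hb : 0 < b) (hab : b < a) (hA : 0 < A)
    (hB : 0 < B) (hconfocal : A ^ 2 - B ^ 2 = a ^ 2 - b ^ 2) {M : ℕ → Plane}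
    (hM : IsBilliardTrajectory A B M) (hγ : Circumscribes M a b) :
    a < A ∧ ∃ (T : ℕ → Plane) (t : ℕ → ℝ) (ε : ℝ), ε ^ 2 = 1 ∧
      (∀ i, T i ∈ ellipse a b ∧ sideLine M i = ellipseTangentLine a b (T i) ∧
        T i 0 = a * Real.cos (t i) ∧ T i 1 = ε * (b * Real.sin (t i))) ∧
      ∀ i, IsNextAngle (1 - a ^ 2 / A ^ 2 + b ^ 2 / B ^ 2) (1 + a ^ 2 / A ^ 2 - b ^ 2 / B ^ 2)
        (a ^ 2 / A ^ 2 + b ^ 2 / B ^ 2 - 1) (t i) (t (i + 1)) := by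
  have ha : 0 < a := hb.trans hab
  choose T hT hl using hγ
  have hTne (i : ℕ) : T i ≠ T (i + 1) :=
    tangency_points_ne hb hab hA hB hconfocal hM (hT i) (hl i) (hl (i + 1))
  obtain ⟨e₀, he₀⟩ : ∃ e : ℕ → ℝ, ∀ i, T i 0 = a * e i :=
    ⟨fun i => T i 0 / a, fun i => by field_simp⟩
  obtain ⟨e₁, he₁⟩ : ∃ e : ℕ → ℝ, ∀ i, T i 1 = b * e i :=
    ⟨fun i => T i 1 / b, fun i => by field_simp⟩
  obtain ⟨x, hx⟩ : ∃ e : ℕ → ℝ, ∀ i, M i 0 = a * e i :=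
    ⟨fun i => M i 0 / a, fun i => by field_simp⟩
  obtain ⟨y, hy⟩ : ∃ e : ℕ → ℝ, ∀ i, M i 1 = b * e i :=
    ⟨fun i => M i 1 / b, fun i => by field_simp⟩
  have he (i : ℕ) : e₀ i ^ 2 + e₁ i ^ 2 = 1 := by
    have h : T i 0 ^ 2 / a ^ 2 + T i 1 ^ 2 / b ^ 2 = 1 := hT i
    rw [he₀, he₁] at h
    field_simp at h
    linarith
  have hmem (i : ℕ) (X : Plane) (h : X ∈ sideLine M i) {u v : ℝ} (hu : X 0 = a * u)
      (hv : X 1 = b * v) : e₀ i * u + e₁ i * v = 1 := by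
    rw [hl, mem_ellipseTangentLine (hT i), he₀, he₁, hu, hv] at h
    field_simp at h
    linarith
  have hl1 (i : ℕ) : e₀ i * x i + e₁ i * y i = 1 :=
    hmem i (M i) (left_mem_affineSpan_pair ℝ _ _) (hx i) (hy i)
  have hl2 (i : ℕ) : e₀ i * x (i + 1) + e₁ i * y (i + 1) = 1 :=
    hmem i (M (i + 1)) (right_mem_affineSpan_pair ℝ _ _) (hx _) (hy _)
  have hE (i : ℕ) : a ^ 2 / A ^ 2 * x i ^ 2 + b ^ 2 / B ^ 2 * y i ^ 2 = 1 := by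
    have h : M i 0 ^ 2 / A ^ 2 + M i 1 ^ 2 / B ^ 2 = 1 := hM.mem_ellipse i
    rw [hx, hy] at h
    linear_combination h
  obtain ⟨μ, hμ⟩ : ∃ μ : ℕ → ℝ, ∀ i, μ i = e₀ i * y (i + 1) - e₁ i * x (i + 1) := ⟨_, fun _ => rfl⟩
  obtain ⟨ν, hν⟩ : ∃ ν : ℕ → ℝ, ∀ i, ν i = e₁ i * x i - e₀ i * y i := ⟨_, fun _ => rfl⟩
  have hx2 (i : ℕ) : x (i + 1) = e₀ i - μ i * e₁ i := by
    rw [hμ]; linear_combination e₀ i * hl2 i - x (i + 1) * he i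
  have hy2 (i : ℕ) : y (i + 1) = e₁ i + μ i * e₀ i := by
    rw [hμ]; linear_combination e₁ i * hl2 i - y (i + 1) * he i
  have hx1 (i : ℕ) : x i = e₀ i + ν i * e₁ i := by
    rw [hν]; linear_combination e₀ i * hl1 i - x i * he i
  have hy1 (i : ℕ) : y i = e₁ i - ν i * e₀ i := by
    rw [hν]; linear_combination e₁ i * hl1 i - y i * he i
  have hsum (i : ℕ) : μ i + ν i ≠ 0 := by
    intro h
    have h : ν i = -μ i := by linarith
    apply hM.ne_succ i
    apply plane_ext
    · rw [hx, hx, hx1, hx2, h]; ring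
    · rw [hy, hy, hy1, hy2, h]; ring
  have hnorm1 (i : ℕ) : x i ^ 2 + y i ^ 2 = 1 + ν i ^ 2 := by
    rw [hx1, hy1]; linear_combination (1 + ν i ^ 2) * he i
  have hnorm2 (i : ℕ) : x (i + 1) ^ 2 + y (i + 1) ^ 2 = 1 + μ i ^ 2 := by
    rw [hx2, hy2]; linear_combination (1 + μ i ^ 2) * he i
  have hνμ (i : ℕ) : ν (i + 1) = μ i := by
    -- The two tangent lengths from a vertex agree up to sign. The opposite sign would make the
    -- points of tangency coincide; this exclusion is the only use of the reflection law.
    have : ν (i + 1) ^ 2 = μ i ^ 2 := by linarith [hnorm1 (i + 1), hnorm2 i]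
    rcases sq_eq_sq_iff_eq_or_eq_neg.1 this with h | h
    · exact h
    exfalso
    have hpos : 1 + μ i ^ 2 ≠ 0 := by positivity
    have p0 := hx2 i
    have p1 := hy2 i
    rw [hx1, h] at p0
    rw [hy1, h] at p1
    apply hTne i
    apply plane_ext
    · rw [he₀, he₀]
      congr 1
      apply mul_right_cancel₀ hpos
      linear_combination -p0 - μ i * p1
    · rw [he₁, he₁]
      congr 1
      apply mul_right_cancel₀ hpos
      linear_combination -p1 + μ i * p0
  -- Otherwise E lies in the closed region bounded by γ, all tangent lengths vanish, and a side has
  -- equal endpoints.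
  have haA : a < A := by
    by_contra! hle
    have h1 : 1 ≤ a ^ 2 / A ^ 2 := by rw [one_le_div (by positivity)]; gcongr
    have h2 : 1 ≤ b ^ 2 / B ^ 2 := by
      rw [one_le_div (by positivity)]; nlinarith
    have hle1 (i : ℕ) : x i ^ 2 + y i ^ 2 ≤ 1 := by
      nlinarith [hE i, mul_le_mul_of_nonneg_right h1 (sq_nonneg (x i)),
        mul_le_mul_of_nonneg_right h2 (sq_nonneg (y i))]
    have z1 : ν 0 = 0 := by nlinarith [hle1 0, hnorm1 0]
    have z2 : μ 0 = 0 := by nlinarith [hle1 1, hnorm2 0]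
    exact hsum 0 (by rw [z1, z2, add_zero])
  refine ⟨haA, ?_⟩
  have hα : a ^ 2 / A ^ 2 < 1 := by rw [div_lt_one (by positivity)]; gcongr
  have hβ : b ^ 2 / B ^ 2 < 1 := by rw [div_lt_one (by positivity)]; nlinarith
  have hE2 (i : ℕ) : a ^ 2 / A ^ 2 * (e₀ i - μ i * e₁ i) ^ 2 +
      b ^ 2 / B ^ 2 * (e₁ i + μ i * e₀ i) ^ 2 = 1 := by rw [← hx2, ← hy2]; exact hE _
  have hsign (i : ℕ) : 0 < ν i * μ i := by
    refine tangent_lengths_mul_pos (by positivity) hα (by positivity) hβ (he i) (hE2 i) ?_ (hsum i)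
    rw [← hx1, ← hy1]
    exact hE i
  have hstep (i : ℕ) : 0 < μ i * μ (i + 1) := by rw [← hνμ]; exact hsign _
  have h₀ (i : ℕ) : e₀ i - μ i * e₁ i = e₀ (i + 1) + μ i * e₁ (i + 1) := by
    rw [← hx2, hx1, hνμ]
  have h₁ (i : ℕ) : e₁ i + μ i * e₀ i = e₁ (i + 1) - μ i * e₀ (i + 1) := by
    rw [← hy2, hy1, hνμ]
  rcases lt_or_gt_of_ne (left_ne_zero_of_mul (hstep 0).ne') with hneg | hpos
  -- A clockwise orbit is made counterclockwise by reflection in the major axis, whence ε = -1.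
  · have hμneg (i : ℕ) : μ i < 0 := by
      induction i with
      | zero => exact hneg
      | succ i ih => exact neg_of_mul_pos_right (hstep i) ih.le
    obtain ⟨t, ht, hn⟩ := exists_angle_seq (α := a ^ 2 / A ^ 2) (β := b ^ 2 / B ^ 2) (e₀ := e₀)
      (e₁ := fun i => -e₁ i) (μ := fun i => -μ i) (fun i => by rw [neg_sq, he])
      (fun i => neg_pos.2 (hμneg i)) (fun i => by linear_combination h₀ i)
      (fun i => by linear_combination -h₁ i) (fun i => by linear_combination hE2 i)
    refine ⟨T, t, -1, by norm_num, fun i => ⟨hT i, hl i, ?_, ?_⟩, hn⟩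
    · rw [← (ht i).1, he₀]
    · rw [← (ht i).2, he₁]; ring
  · have hμpos (i : ℕ) : 0 < μ i := by
      induction i with
      | zero => exact hpos
      | succ i ih => exact pos_of_mul_pos_right (hstep i) ih.le
    obtain ⟨t, ht, hn⟩ := exists_angle_seq he hμpos h₀ h₁ hE2
    refine ⟨T, t, 1, by norm_num, fun i => ⟨hT i, hl i, ?_, ?_⟩, hn⟩
    · rw [← (ht i).1, he₀]
    · rw [← (ht i).2, he₁]; ring

end Geometry

/-! ### Products over a period and distances to tangents -/

section Products

theorem prod_range_shift {u : ℕ → ℝ} (hu : ∀ i, 0 < u i) {n : ℕ} (hper : ∀ i, u (i + n) = u i)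
    (m : ℕ) : ∏ i ∈ Finset.range n, u (i + m) = ∏ i ∈ Finset.range n, u i := by
  induction m with
  | zero => rfl
  | succ m ih =>
    rw [← ih]
    apply mul_right_cancel₀ (hu m).ne'
    have h1 := Finset.prod_range_succ' (fun i => u (i + m)) n
    rw [Finset.prod_range_succ] at h1
    simp only [zero_add, add_right_comm _ 1 m] at h1
    rw [add_comm n m, hper] at h1
    exact h1.symm

/-- The shifted product over a full period is the same product, so the square pairs each factor with
its shift. -/
theorem prod_sq_of_mul_shift {u : ℕ → ℝ} (hu : ∀ i, 0 < u i) {n : ℕ}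
    (hper : ∀ i, u (i + n) = u i) {m : ℕ} {C : ℝ} (h : ∀ i, u i * u (i + m) = C) :
    (∏ i ∈ Finset.range n, u i) ^ 2 = C ^ n := by
  rw [sq]
  nth_rewrite 2 [← prod_range_shift hu hper m]
  rw [← Finset.prod_mul_distrib, Finset.prod_congr rfl fun i _ => h i, Finset.prod_const,
    Finset.card_range]

theorem conjugateRadius_add_pi (a b t : ℝ) :
    conjugateRadius a b (t + Real.pi) = conjugateRadius a b t := by
  simp [conjugateRadius]

theorem conjugateRadius_add_nat_mul_pi (a b t : ℝ) (k : ℕ) :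
    conjugateRadius a b (t + k * Real.pi) = conjugateRadius a b t := by
  induction k with
  | zero => simp
  | succ k ih =>
    rw [← ih, ← conjugateRadius_add_pi a b (t + k * Real.pi)]; push_cast; ring_nf

theorem conjugateRadius_mul_iterate_quarterShift {a b : ℝ} (ha : 0 < a) (hb : 0 < b) {k : ℕ}
    (hk : Odd k) (t : ℝ) :
    conjugateRadius a b t * conjugateRadius a b ((quarterShift a b)^[k] t) = a * b := by
  obtain ⟨j, rfl⟩ := hk
  have h : conjugateRadius a b ((quarterShift a b)^[2 * j + 1] t) =
      conjugateRadius a b (quarterShift a b t) := by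
    induction j with
    | zero => rfl
    | succ j ih =>
      rw [show 2 * (j + 1) + 1 = 2 * j + 1 + 1 + 1 by ring, Function.iterate_succ_apply',
        Function.iterate_succ_apply', quarterShift_quarterShift ha hb, conjugateRadius_add_pi, ih]
  rw [h, conjugateRadius_mul_quarterShift ha hb]

theorem dist_foot_eq {a b : ℝ} (ha : 0 < a) (hb : 0 < b) {T : Plane} (hT : T ∈ ellipse a b)
    {t ε : ℝ} (hε : ε ^ 2 = 1) (h0 : T 0 = a * Real.cos t) (h1 : T 1 = ε * (b * Real.sin t))
    {l : AffineSubspace ℝ Plane} [Nonempty l] (hl : l = ellipseTangentLine a b T) {f : ℝ}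
    (hf : |f| < a) {X : Plane} (hX0 : X 0 = f) (hX1 : X 1 = 0) :
    dist X (EuclideanGeometry.orthogonalProjection l X) =
      b * (a - f * Real.cos t) / conjugateRadius a b t ∧ 0 < a - f * Real.cos t := by
  have hpos : 0 < a - f * Real.cos t := by
    have : |f * Real.cos t| ≤ |f| := by
      rw [abs_mul]; exact mul_le_of_le_one_right (abs_nonneg _) (Real.abs_cos_le_one t)
    linarith [le_abs_self (f * Real.cos t)]
  refine ⟨?_, hpos⟩
  have hD := conjugateRadius_pos ha hb t
  have hsq : √((T 0 / a ^ 2) ^ 2 + (T 1 / b ^ 2) ^ 2) = conjugateRadius a b t / (a * b) := by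
    rw [Real.sqrt_eq_iff_mul_self_eq (by positivity) (by positivity), ← sq,
      div_pow (conjugateRadius a b t), conjugateRadius_sq, h0, h1]
    field_simp
    rw [hε]; ring
  have habs : T 0 / a ^ 2 * X 0 + T 1 / b ^ 2 * X 1 - 1 = -((a - f * Real.cos t) / a) := by
    rw [hX0, hX1, h0]; field_simp; ring
  rw [dist_foot_of_eq_tangentLine hT hl, hsq, habs, abs_neg, abs_of_pos (by positivity)]
  field_simp

theorem eq_of_mem_tangentLines {a b : ℝ} (ha : 0 < a) (hb : 0 < b) {T T' : Plane}
    (hT : T ∈ ellipse a b) (hT' : T' ∈ ellipse a b) (h : T 0 * T' 1 ≠ T' 0 * T 1) {X Y : Plane}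
    (hX : X ∈ ellipseTangentLine a b T) (hX' : X ∈ ellipseTangentLine a b T')
    (hY : Y ∈ ellipseTangentLine a b T) (hY' : Y ∈ ellipseTangentLine a b T') : X = Y := by
  rw [mem_ellipseTangentLine hT] at hX hY
  rw [mem_ellipseTangentLine hT'] at hX' hY'
  field_simp at hX hX' hY hY'
  have h := sub_ne_zero.2 h
  apply plane_ext
  · apply mul_left_cancel₀ (mul_ne_zero (pow_ne_zero 2 hb.ne') h)
    linear_combination T' 1 * (hX - hY) - T 1 * (hX' - hY')
  · apply mul_left_cancel₀ (mul_ne_zero (pow_ne_zero 2 ha.ne') h)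
    linear_combination T 0 * (hX' - hY') - T' 0 * (hX - hY)

end Products

/-! ### The products of the distances -/

theorem mainTheorem3 (a b A B : ℝ) (hb : 0 < b) (hab : b < a) (hA : 0 < A) (hB : 0 < B)
    (hconfocal : A ^ 2 - B ^ 2 = a ^ 2 - b ^ 2)
    (n : ℕ) (M : ℕ → Plane) (hM : IsPeriodicBilliardOrbit A B n M) (hγ : Circumscribes M a b) :
    (Even n →
      (∏ i ∈ Finset.range n, dist (focus₁ a b) (footOnSide M (focus₁ a b) i) = b ^ n) ∧
      (∏ i ∈ Finset.range n, dist (focus₂ a b) (footOnSide M (focus₂ a b) i) = b ^ n)) ∧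
    (4 ∣ n →
      ∏ i ∈ Finset.range n, dist (0 : Plane) (footOnSide M 0 i) = (a * b) ^ (n / 2)) := by
  have ha : 0 < a := hb.trans hab
  obtain ⟨haA, T, t, ε, hε, hT, ht⟩ :=
    exists_tangency_angles hb hab hA hB hconfocal hM.trajectory hγ
  obtain ⟨hn0, hper⟩ : 0 < n ∧ Function.Periodic M n := hM.period.1
  have hα0 : 0 < a ^ 2 / A ^ 2 := by positivity
  have hβ0 : 0 < b ^ 2 / B ^ 2 := by positivity
  have hα1 : a ^ 2 / A ^ 2 < 1 := by rw [div_lt_one (by positivity)]; gcongr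
  have hβ1 : b ^ 2 / B ^ 2 < 1 := by rw [div_lt_one (by positivity)]; nlinarith
  have hcay : a ^ 2 * (1 - a ^ 2 / A ^ 2) * (b ^ 2 / B ^ 2) =
      b ^ 2 * (1 - b ^ 2 / B ^ 2) * (a ^ 2 / A ^ 2) := by
    field_simp
    linear_combination hconfocal
  generalize a ^ 2 / A ^ 2 = α at *
  generalize b ^ 2 / B ^ 2 = β at *
  have hP : |α + β - 1| < 1 - α + β := abs_lt.2 ⟨by linarith, by linarith⟩
  have hQ : |α + β - 1| < 1 + α - β := abs_lt.2 ⟨by linarith, by linarith⟩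
  have hPQR : (α + β - 1) ^ 2 * (a ^ 2 - b ^ 2) =
      (1 - α + β) ^ 2 * a ^ 2 - (1 + α - β) ^ 2 * b ^ 2 := by
    linear_combination (-4) * hcay
  have htmono : StrictMono t := strictMono_nat_of_lt_succ fun i => (ht i).lt
  obtain ⟨k, hk⟩ : ∃ k : ℕ, t n = t 0 + k * (2 * Real.pi) := by
    have hl : sideLine M n = sideLine M 0 := by
      rw [sideLine, sideLine, add_comm n 1, hper, zero_add, ← hper.eq]
    -- T n lies on γ and on the tangent at T 0. In angles this incidence says cos (t n - t 0) = 1.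
    have hmem : T n ∈ ellipseTangentLine a b (T 0) := by
      rw [← (hT 0).2.1, ← hl, (hT n).2.1]
      exact AffineSubspace.self_mem_mk' _ _
    rw [mem_ellipseTangentLine (hT 0).1, (hT 0).2.2.1, (hT 0).2.2.2, (hT n).2.2.1,
      (hT n).2.2.2] at hmem
    have hcos : Real.cos (t n - t 0) = 1 := by
      rw [Real.cos_sub, ← hmem]
      field_simp
      rw [hε]; ring
    obtain ⟨k, hk⟩ := (Real.cos_eq_one_iff _).1 hcos
    have hk0 : 0 ≤ k := by
      have h1 : 0 < (k : ℝ) * (2 * Real.pi) := by rw [hk]; linarith [htmono hn0]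
      have h2 : (0 : ℝ) < k := pos_of_mul_pos_left h1 (by positivity)
      exact_mod_cast h2.le
    lift k to ℕ using hk0
    exact ⟨k, by push_cast at hk; linarith⟩
  have hpi_mono (c : ℝ) : StrictMono fun x : ℝ => x + c := fun _ _ h => by simpa using h
  have htn (i : ℕ) : t (i + n) = t i + k * (2 * Real.pi) := by
    rw [shift_eq_iterate (q := 1) hP hQ ht (hpi_mono (2 * Real.pi)) (fun s u h => by
      simpa only [add_assoc, ← two_mul] using h.add_pi.add_pi) one_pos (fun _ => rfl)
      (by rw [one_mul, hk]), add_right_iterate, nsmul_eq_mul]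
  have hthalf {m : ℕ} (hm : n = 2 * m) (i : ℕ) : t (i + m) = t i + k * Real.pi := by
    rw [shift_eq_iterate (q := 2) hP hQ ht (hpi_mono Real.pi) (fun s u h => h.add_pi) two_pos
      (fun x => by simp only [Function.iterate_succ, Function.iterate_zero, Function.comp_apply, id]
                   ring) (by rw [← hm, hk]), add_right_iterate, nsmul_eq_mul]
  have hkodd {m : ℕ} (hm : n = 2 * m) : Odd k := by
    rw [← Nat.not_even_iff_odd]
    rintro ⟨j, rfl⟩
    have hTm (i : ℕ) : T (i + m) = T i := by
      have e : t (i + m) = t i + j * (2 * Real.pi) := by rw [hthalf hm]; push_cast; ring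
      apply plane_ext
      · rw [(hT _).2.2.1, (hT _).2.2.1, e, Real.cos_add_nat_mul_two_pi]
      · rw [(hT _).2.2.2, (hT _).2.2.2, e, Real.sin_add_nat_mul_two_pi]
    have hMm (i : ℕ) : M (i + m + 1) = M (i + 1) := by
      have hdet : T i 0 * T (i + 1) 1 ≠ T (i + 1) 0 * T i 1 := by
        have hsin : 0 < Real.sin (t (i + 1) - t i) := Real.sin_pos_of_pos_of_lt_pi
          (by linarith [(ht i).lt]) (by linarith [(ht i).lt_add_pi])
        have hε0 : ε ≠ 0 := by rintro rfl; norm_num at hε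
        rw [← sub_ne_zero, (hT i).2.2.1, (hT i).2.2.2, (hT (i + 1)).2.2.1, (hT (i + 1)).2.2.2]
        have e : a * Real.cos (t i) * (ε * (b * Real.sin (t (i + 1)))) -
            a * Real.cos (t (i + 1)) * (ε * (b * Real.sin (t i))) =
            a * b * ε * Real.sin (t (i + 1) - t i) := by rw [Real.sin_sub]; ring
        rw [e]
        exact mul_ne_zero (mul_ne_zero (mul_ne_zero ha.ne' hb.ne') hε0) hsin.ne'
      have hr (j : ℕ) : M (j + 1) ∈ ellipseTangentLine a b (T j) := by
        rw [← (hT j).2.1]; exact right_mem_affineSpan_pair ℝ _ _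
      have hl (j : ℕ) : M j ∈ ellipseTangentLine a b (T j) := by
        rw [← (hT j).2.1]; exact left_mem_affineSpan_pair ℝ _ _
      refine eq_of_mem_tangentLines ha hb (hT i).1 (hT (i + 1)).1 hdet ?_ ?_ (hr i) (hl (i + 1))
      · rw [← hTm]; exact hr _
      · rw [← hTm (i + 1), add_right_comm i 1 m]; exact hl _
    have hmper : Function.Periodic M m := by
      intro x
      obtain ⟨r, rfl⟩ : ∃ r, n = r + 1 := ⟨n - 1, by omega⟩
      rw [← hper (x + m), ← hper x, ← add_assoc, ← add_assoc, add_right_comm x m r, hMm]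
    have := hM.period.2 ⟨by omega, hmper⟩
    omega
  have hdist {f : ℝ} (hf : |f| < a) {X : Plane} (hX0 : X 0 = f) (hX1 : X 1 = 0) (i : ℕ) :=
    dist_foot_eq ha hb (hT i).1 hε (hT i).2.2.1 (hT i).2.2.2 (hT i).2.1 hf hX0 hX1
  have hD (i : ℕ) := conjugateRadius_pos ha hb (t i)
  have hpos {f : ℝ} (hf : |f| < a) {X : Plane} (hX0 : X 0 = f) (hX1 : X 1 = 0) (i : ℕ) :
      0 < dist X (footOnSide M X i) := by
    rw [footOnSide, (hdist hf hX0 hX1 i).1]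
    exact div_pos (mul_pos hb (hdist hf hX0 hX1 i).2) (hD i)
  have hperiod {f : ℝ} (hf : |f| < a) {X : Plane} (hX0 : X 0 = f) (hX1 : X 1 = 0) (i : ℕ) :
      dist X (footOnSide M X (i + n)) = dist X (footOnSide M X i) := by
    have e : t (i + n) = t i + (k * 2 : ℕ) * Real.pi := by rw [htn]; push_cast; ring
    rw [footOnSide, footOnSide, (hdist hf hX0 hX1 i).1, (hdist hf hX0 hX1 (i + n)).1, e,
      conjugateRadius_add_nat_mul_pi, Real.cos_add_nat_mul_pi, pow_mul']
    norm_num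
  have hfocus {f : ℝ} (hf2 : f ^ 2 = a ^ 2 - b ^ 2) {X : Plane} (hX0 : X 0 = f) (hX1 : X 1 = 0)
      (hn : Even n) : ∏ i ∈ Finset.range n, dist X (footOnSide M X i) = b ^ n := by
    obtain ⟨m, hm⟩ := hn
    have hm : n = 2 * m := by omega
    have hf : |f| < a := abs_lt_of_sq_lt_sq (by nlinarith) ha.le
    -- As k is odd, the cosine changes sign after half a period, and (a - f cos t)(a + f cos t) = a²
    -- - f² cos² t = D(t)².
    have key := prod_sq_of_mul_shift (m := m) (C := b ^ 2) (hpos hf hX0 hX1) (hperiod hf hX0 hX1)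
      fun i => by
        have h1 := hD i
        have h2 := conjugateRadius_sq a b (t i)
        rw [footOnSide, footOnSide, (hdist hf hX0 hX1 i).1, (hdist hf hX0 hX1 (i + m)).1,
          hthalf hm, conjugateRadius_add_nat_mul_pi, Real.cos_add_nat_mul_pi, (hkodd hm).neg_one_pow]
        field_simp
        linear_combination (-a ^ 2) * Real.sin_sq_add_cos_sq (t i) - h2 - Real.cos (t i) ^ 2 * hf2
    rw [← pow_mul, mul_comm 2 n, pow_mul] at key
    exact (sq_eq_sq₀ (Finset.prod_nonneg fun _ _ => dist_nonneg) (by positivity)).1 key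
  have hc : 0 ≤ a ^ 2 - b ^ 2 := by nlinarith
  refine ⟨fun hn => ⟨hfocus (f := -√(a ^ 2 - b ^ 2)) (by rw [neg_sq, Real.sq_sqrt hc])
    (by simp [focus₁]) (by simp [focus₁]) hn, hfocus (Real.sq_sqrt hc)
    (by simp [focus₂]) (by simp [focus₂]) hn⟩, ?_⟩
  rintro ⟨m, hm⟩
  have hf : |(0 : ℝ)| < a := by simpa using ha
  have hX0 : (0 : Plane) 0 = 0 := rfl
  have hX1 : (0 : Plane) 1 = 0 := rfl
  have hquarter (i : ℕ) : t (i + m) = (quarterShift a b)^[k] (t i) :=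
    shift_eq_iterate hP hQ ht (quarterShift_strictMono ha hb)
      (fun s u h => h.map_quarterShift hb hab hP hQ hPQR) four_pos
      (quarterShift_iterate_four ha hb) (by rw [← hm, hk]) i
  have key := prod_sq_of_mul_shift (m := m) (C := a * b) (hpos hf hX0 hX1) (hperiod hf hX0 hX1)
    fun i => by
      have h1 := hD i
      have h2 := hD (i + m)
      have h3 := conjugateRadius_mul_iterate_quarterShift ha hb
        (hkodd (m := 2 * m) (by omega)) (t i)
      rw [← hquarter] at h3
      rw [footOnSide, footOnSide, (hdist hf hX0 hX1 i).1, (hdist hf hX0 hX1 (i + m)).1]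
      field_simp
      linear_combination (-a) * h3
  have hn2 : n = n / 2 * 2 := by omega
  rw [show (a * b) ^ n = ((a * b) ^ (n / 2)) ^ 2 by rw [← pow_mul, ← hn2]] at key
  exact (sq_eq_sq₀ (Finset.prod_nonneg fun _ _ => dist_nonneg) (by positivity)).1 key
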